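/- Let $F$ be a non-archimedean, non-discrete, locally compact field (of any characteristic), $\mathbb G$ a connected reductive algebraic group over $F$, and $G=\mathbb G(F)$ with its $p$-adic topology and a Haar measure $\mu$. Representations are over $\mathbb C$. Let $J$ be a compact open subgroup of $G$ and $(\lambda ,W)$ an irreducible smooth (hence finite-dimensional) representation of $J$, with contragredient $(\tilde\lambda ,\tilde W)$. Let $\mathcal S_\lambda (G)$ be the category of the smooth representations of $G$ that are generated by their $\lambda$-isotypic component, and assume that $(J,\lambda )$ is a type, i.e. that $\mathcal S_\lambda (G)$ is stable under subquotients. Let $\bar{\mathcal H}_\lambda$ be the space of all functions $\Psi : G\to \mathrm{End}_{\mathbb C}(\tilde W)$ with $\Psi (j_1gj_2)=\tilde\lambda (j_1)\Psi (g)\tilde\lambda (j_2)$ for $j_1,j_2\in J$, $g\in G$, and let $\mathcal H_\lambda$ be the subspace of compactly supported functions. For $\varphi\in\mathcal H_\lambda$ and $\Psi\in\bar{\mathcal H}_\lambda$ put $$(\varphi\star\Psi )(g)=\int_G\varphi (x)\Psi (x^{-1}g)\,d\mu (x)=\mu (J)\sum_{x\in G/J}\varphi (x)\Psi (x^{-1}g);$$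 this makes $\mathcal H_\lambda$ an algebra. For a smooth representation $(\pi ,\mathcal V)$ of $G$, $\mathcal H_\lambda$ acts on $\mathrm{Hom}_J(\lambda ,\pi )$ by $$(\varphi\cdot h)(w)=\int_G\pi (x)\,h({}^t\varphi (x)w)\,d\mu (x)=\mu(J)\sum_{x\in G/J}\pi (x)\,h({}^t\varphi (x)w),$$ where ${}^t\varphi (x)\in\mathrm{End}(W)$ is the transpose of $\varphi (x)$. Let $\pi\in\mathcal S_\lambda (G)$ be irreducible with (H): $\dim_{\mathbb C}\mathrm{Hom}_J(\lambda ,\pi )=1$, let $\chi$ be the character through which $\mathcal H_\lambda$ acts on the line $\mathrm{Hom}_J(\lambda ,\pi )$, and let $${}_\chi\bar{\mathcal H}_\lambda =\{\Psi\in\bar{\mathcal H}_\lambda : \varphi\star\Psi =\chi (\varphi )\Psi\ \text{ for all }\varphi\in\mathcal H_\lambda\}.$$ Theorem. (i) $\dim_{\mathbb C}{}_\chi\bar{\mathcal H}_\lambda\le 1$. (ii) For all $\Psi\in{}_\chi\bar{\mathcal H}_\lambda$, $w\in W$ and $\tilde w\in\tilde W$, the function $$g\mapsto\langle w,\Psi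 (g^{-1})\tilde w\rangle =\langle\tilde\Psi (g)w,\tilde w\rangle ,\qquad \tilde\Psi (g):={}^t\Psi (g^{-1}),$$ is a matrix coefficient of $\pi$, i.e. of the form $g\mapsto\langle\pi (g)v,\tilde v\rangle$ with $v$ in the space of $\pi$ and $\tilde v$ in the space of the contragredient (smooth dual) of $\pi$. -/

import Mathlib

open scoped TensorProduct

universe u v w

noncomputable section

namespace TypeTheory

/-! ### Connected reductive groups over a field, through their Hopf algebras -/

section Reductive

/-- The group `𝔾(k) = Hom_{k-alg}(A, k)` of `k`-rational points of the affine `k`-group scheme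
`𝔾 = Spec A`; the group law is `(g * h)(a) = ∑ g(a₁) h(a₂)` where `Δ a = ∑ a₁ ⊗ a₂`. -/
def RationalPoints (k : Type u) (A : Type v) [Field k] [CommRing A] [HopfAlgebra k A] :
    Type (max u v) :=
  WithConv (A →ₐ[k] k)

variable (k : Type u) (A : Type v) [Field k] [CommRing A] [HopfAlgebra k A]

instance : Group (RationalPoints k A) :=
  inferInstanceAs (Group (WithConv (A →ₐ[k] k)))

variable {k A} in
/-- The value `a(g)` of the regular function `a` at the rational point `g`. -/
def RationalPoints.eval (g : RationalPoints k A) : A →ₐ[k] k :=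
  WithConv.ofConv g

/-- The topology of `𝔾(k)` induced by a topology of `k`: the coarsest one for which all regular
functions are continuous (for `A` of finite type, the subspace topology of `𝔾(k) ⊆ kⁿ` for any
closed embedding of `𝔾` into affine space). -/
instance [TopologicalSpace k] : TopologicalSpace (RationalPoints k A) :=
  TopologicalSpace.induced (fun g (a : A) => g.eval a) inferInstance

lemma RationalPoints.continuous_eval [TopologicalSpace k] (a : A) :
    Continuous fun g : RationalPoints k A => g.eval a :=
  (continuous_apply a).comp continuous_induced_dom

instance [TopologicalSpace k] [IsTopologicalRing k] : IsTopologicalGroup (RationalPoints k A) where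
  continuous_mul := by
    refine continuous_induced_rng.2 (continuous_pi fun a => ?_)
    have h : ∀ p : RationalPoints k A × RationalPoints k A, (p.1 * p.2).eval a =
        ∑ i ∈ (Coalgebra.Repr.arbitrary k a).index,
          p.1.eval ((Coalgebra.Repr.arbitrary k a).left i) *
            p.2.eval ((Coalgebra.Repr.arbitrary k a).right i) := fun p =>
      (Coalgebra.Repr.arbitrary k a).convMul_apply (WithConv.toConv p.1.eval.toLinearMap)
        (WithConv.toConv p.2.eval.toLinearMap)
    simp only [Function.comp_def, h]
    exact continuous_finsetSum _ fun i _ =>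
      ((RationalPoints.continuous_eval k A _).comp continuous_fst).mul
        ((RationalPoints.continuous_eval k A _).comp continuous_snd)
  continuous_inv := by
    refine continuous_induced_rng.2 (continuous_pi fun a => ?_)
    exact RationalPoints.continuous_eval k A (HopfAlgebra.antipode k a)

/-- The Zariski topology on the set of rational points. -/
@[reducible]
def zariskiTopology : TopologicalSpace (RationalPoints k A) :=
  TopologicalSpace.induced
    (fun g => (⟨RingHom.ker g.eval, RingHom.ker_isPrime _⟩ : PrimeSpectrum A)) inferInstance

variable {k A} in
/-- Translation of regular functions by a rational point: `(ρ(g) a)(x) = a(x g)`. -/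
def rightTranslation (g : RationalPoints k A) : Module.End k A :=
  (TensorProduct.rid k A).toLinearMap ∘ₗ LinearMap.lTensor A g.eval.toLinearMap ∘ₗ
    Coalgebra.comul

variable {k A} in
/-- A rational point is unipotent if it acts locally unipotently on the regular functions. -/
def IsUnipotentPoint (g : RationalPoints k A) : Prop :=
  ∀ a : A, ∃ n : ℕ, ((rightTranslation g - 1) ^ n) a = 0

/-- For `k` algebraically closed and `𝔾 = Spec A` reduced: the unipotent radical of `𝔾` is trivial,
that is, every Zariski closed, connected, normal subgroup of `𝔾(k)` that consists of unipotent
elements is trivial. -/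
def HasTrivialUnipotentRadical : Prop :=
  ∀ N : Subgroup (RationalPoints k A), N.Normal →
    @IsClosed _ (zariskiTopology k A) (N : Set (RationalPoints k A)) →
    @IsConnected _ (zariskiTopology k A) (N : Set (RationalPoints k A)) →
    (∀ g ∈ N, IsUnipotentPoint g) → N = ⊥

/-- `𝔾 = Spec A` is a connected reductive algebraic group over `k`: it is of finite type, smooth
(that is, geometrically reduced) and connected, and over an algebraic closure of `k` its unipotent
radical is trivial. -/
structure IsConnectedReductive : Prop where
  finiteType : Algebra.FiniteType k A
  geometricallyReduced : IsReduced (AlgebraicClosure k ⊗[k] A)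
  connected : ConnectedSpace (PrimeSpectrum A)
  unipotentRadical_trivial :
    HasTrivialUnipotentRadical (AlgebraicClosure k) (AlgebraicClosure k ⊗[k] A)

end Reductive

/-! ### Smooth representations, types, Hecke algebras -/

section Smooth

variable {G : Type u} [Group G] [TopologicalSpace G]

/-- A complex representation is smooth if the stabilizer of every vector is open. -/
def IsSmooth {V : Type v} [AddCommGroup V] [Module ℂ V] (π : Representation ℂ G V) : Prop :=
  ∀ x : V, IsOpen {g : G | π g x = x}

/-- `c` is a matrix coefficient of `π`: `c(g) = ⟨π(g) x, ξ⟩` for some vector `x` of `π` and some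
vector `ξ` of the contragredient of `π`, that is, some linear form `ξ` on the space of `π` whose
stabilizer is open. -/
def IsMatrixCoefficient {V : Type v} [AddCommGroup V] [Module ℂ V] (π : Representation ℂ G V)
    (c : G → ℂ) : Prop :=
  ∃ (x : V) (ξ : Module.Dual ℂ V), IsOpen {g : G | π.dual g ξ = ξ} ∧ ∀ g, c g = ξ (π g x)

variable {J : Subgroup G} {W : Type w} [AddCommGroup W] [Module ℂ W] (ρ : Representation ℂ J W)
variable {V : Type v} [AddCommGroup V] [Module ℂ V] (π : Representation ℂ G V)

/-- `Hom_J(ρ, π)`, the space of the module `M_ρ(π)`. -/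
abbrev HomJ : Type max w v :=
  Representation.IntertwiningMap ρ (MonoidHom.comp π J.subtype)

/-- The `ρ`-isotypic component of `π`, for an irreducible representation `ρ` of `J`. -/
def isotypicComponent : Submodule ℂ V :=
  ⨆ h : HomJ ρ π, LinearMap.range h.toLinearMap

/-- `π` belongs to the category `𝒮_ρ(G)`: it is smooth, and generated, as a representation of `G`,
by its `ρ`-isotypic component. -/
structure MemCategory : Prop where
  smooth : IsSmooth π
  generated : ⨆ g : G, (isotypicComponent ρ π).map (π g) = ⊤

/-- `(J, ρ)` is a type in `G`: `J` is a compact open subgroup of `G`, `ρ` is an irreducible smooth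
representation of `J`, and the category `𝒮_ρ(G)` (of representations on spaces in a universe `v`) is
stable under subquotients. A subquotient of `σ` is a quotient `σ₂` of some `σ₁ ⊆ σ`. -/
structure IsType : Prop where
  isOpen : IsOpen (J : Set G)
  isCompact : IsCompact (J : Set G)
  smooth : IsSmooth ρ
  irreducible : ρ.IsIrreducible
  subquotient : ∀ (V V₁ V₂ : Type v) [AddCommGroup V] [AddCommGroup V₁] [AddCommGroup V₂]
    [Module ℂ V] [Module ℂ V₁] [Module ℂ V₂] (σ : Representation ℂ G V)
    (σ₁ : Representation ℂ G V₁) (σ₂ : Representation ℂ G V₂)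
    (i : Representation.IntertwiningMap σ₁ σ) (p : Representation.IntertwiningMap σ₁ σ₂),
    Function.Injective i → Function.Surjective p → MemCategory ρ σ → MemCategory ρ σ₂

/-- The space `H̄_ρ` of all functions `Ψ : G → End(W̃)` with `Ψ(j g l) = ρ̃(j) Ψ(g) ρ̃(l)` for
`j, l ∈ J`, without condition on the support. Here `(ρ̃, W̃)` is the contragredient of `(ρ, W)`; as
`W` is finite dimensional, `W̃` is the full dual. -/
def bigHecke : Submodule ℂ (G → Module.End ℂ (Module.Dual ℂ W)) where
  carrier := {Ψ | ∀ (j l : J) (g : G), Ψ (j * g * l) = ρ.dual j ∘ₗ Ψ g ∘ₗ ρ.dual l}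
  zero_mem' := by intro j l g; simp
  add_mem' := by
    intro a b ha hb j l g
    simp [ha j l g, hb j l g, LinearMap.comp_add, LinearMap.add_comp]
  smul_mem' := by
    intro c a ha j l g
    simp [ha j l g, LinearMap.comp_smul, LinearMap.smul_comp]

/-- The spherical Hecke algebra `H_ρ`: the compactly supported elements of `H̄_ρ`. Its product is
the convolution below. -/
def heckeAlgebra : Submodule ℂ (G → Module.End ℂ (Module.Dual ℂ W)) where
  carrier := {φ | φ ∈ bigHecke ρ ∧ ∃ C : Set G, IsCompact C ∧ ∀ g ∉ C, φ g = 0}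
  zero_mem' := ⟨zero_mem _, ∅, isCompact_empty, fun _ _ => rfl⟩
  add_mem' := by
    rintro a b ⟨ha, C, hC, haC⟩ ⟨hb, D, hD, hbD⟩
    refine ⟨add_mem ha hb, C ∪ D, hC.union hD, fun g hg => ?_⟩
    simp only [Set.mem_union, not_or] at hg
    simp [haC g hg.1, hbD g hg.2]
  smul_mem' := by
    rintro c a ⟨ha, C, hC, haC⟩
    exact ⟨Submodule.smul_mem _ c ha, C, hC, fun g hg => by simp [haC g hg]⟩

/-- The transpose `ᵗa ∈ End(W)` of `a ∈ End(W̃)`: `⟨ᵗa w, w̃⟩ = ⟨w, a w̃⟩`. -/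
def transpose [FiniteDimensional ℂ W] (a : Module.End ℂ (Module.Dual ℂ W)) : Module.End ℂ W :=
  (Module.evalEquiv ℂ W).symm.toLinearMap ∘ₗ Module.Dual.transpose (R := ℂ) a ∘ₗ
    (Module.evalEquiv ℂ W).toLinearMap

lemma apply_transpose [FiniteDimensional ℂ W] (a : Module.End ℂ (Module.Dual ℂ W)) (x : W)
    (y : Module.Dual ℂ W) : y (transpose a x) = a y x := by
  have := Module.apply_evalEquiv_symm_apply ℂ W y
    ((Module.Dual.transpose (R := ℂ) a) (Module.evalEquiv ℂ W x))
  exact this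

lemma transpose_mul_dual [FiniteDimensional ℂ W] (φ : heckeAlgebra ρ) (g : G) (l : J) :
    transpose (φ.1 (g * l)) = ρ l⁻¹ ∘ₗ transpose (φ.1 g) := by
  ext x
  refine (Module.forall_dual_apply_eq_zero_iff ℂ _).1 (fun y => ?_) |> sub_eq_zero.1
  have h := φ.2.1 1 l g
  rw [map_sub, sub_eq_zero, apply_transpose]
  simp only [OneMemClass.coe_one, one_mul, map_one] at h
  rw [h]
  change (φ.1 g (ρ.dual l y)) x = (y ∘ₗ ρ l⁻¹) (transpose (φ.1 g) x)
  rw [apply_transpose]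
  rfl

lemma transpose_dual_mul [FiniteDimensional ℂ W] (φ : heckeAlgebra ρ) (g : G) (j : J) :
    transpose (φ.1 (j * g)) = transpose (φ.1 g) ∘ₗ ρ j⁻¹ := by
  ext x
  refine (Module.forall_dual_apply_eq_zero_iff ℂ _).1 (fun y => ?_) |> sub_eq_zero.1
  have h := φ.2.1 j 1 g
  rw [map_sub, sub_eq_zero, apply_transpose]
  simp only [OneMemClass.coe_one, mul_one, map_one] at h
  rw [h]
  change (φ.1 g y) (ρ j⁻¹ x) = y (transpose (φ.1 g) (ρ j⁻¹ x))
  rw [apply_transpose]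

lemma heckeAction_equivariant [FiniteDimensional ℂ W] (φ : heckeAlgebra ρ) (h : HomJ ρ π) (j : J) :
    (∑ᶠ x : G ⧸ J, π x.out ∘ₗ h.toLinearMap ∘ₗ transpose (φ.1 x.out)) ∘ₗ ρ j =
      π j ∘ₗ ∑ᶠ x : G ⧸ J, π x.out ∘ₗ h.toLinearMap ∘ₗ transpose (φ.1 x.out) := by
  set T : G → (W →ₗ[ℂ] V) := fun g => π g ∘ₗ h.toLinearMap ∘ₗ transpose (φ.1 g) with hT
  have h1 : ∀ (g : G) (l : J), T (g * l) = T g := by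
    intro g l
    ext x
    have e := Representation.IntertwiningMap.isIntertwining _ _ h l (ρ l⁻¹ (transpose (φ.1 g) x))
    simp only [hT, transpose_mul_dual, map_mul, LinearMap.comp_apply, Module.End.mul_apply]
    congr 1
    change π l (h _) = h _
    refine e.symm.trans ?_
    rw [← Module.End.mul_apply, ← map_mul]
    simp
  have h2 : ∀ (g : G) (k : J), T (k * g) = π k ∘ₗ T g ∘ₗ ρ k⁻¹ := by
    intro g k
    ext x
    simp only [hT, transpose_dual_mul, map_mul, LinearMap.comp_apply, Module.End.mul_apply]
  have h3 : ∀ (g g' : G), (g : G ⧸ J) = g' → T g = T g' := by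
    intro g g' e
    have := h1 g ⟨g⁻¹ * g', QuotientGroup.eq.1 e⟩
    simpa using this.symm
  let L : (W →ₗ[ℂ] V) →+ (W →ₗ[ℂ] V) :=
    { toFun := fun F => π j ∘ₗ F ∘ₗ ρ j⁻¹
      map_zero' := by simp
      map_add' := by intro a b; simp [LinearMap.comp_add, LinearMap.add_comp] }
  have hπ : ∀ v, π (j : G)⁻¹ (π j v) = v := by
    intro v; rw [← Module.End.mul_apply, ← map_mul]; simp
  have hρ : ∀ x, ρ j⁻¹ (ρ j x) = x := by
    intro v; rw [← Module.End.mul_apply, ← map_mul]; simp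
  have hL : Function.Injective L := by
    intro a b hab
    ext x
    have := congrArg (fun F : W →ₗ[ℂ] V => π (j : G)⁻¹ (F (ρ j x))) hab
    simpa [L, hπ, hρ] using this
  have key : L (∑ᶠ x : G ⧸ J, T x.out) = ∑ᶠ x : G ⧸ J, T x.out := by
    rw [AddMonoidHom.map_finsum_of_injective L hL]
    rw [← finsum_comp_equiv (MulAction.toPerm (j : G) : Equiv.Perm (G ⧸ J))
      (f := fun x => T x.out)]
    refine finsum_congr fun x => ?_
    change π j ∘ₗ T x.out ∘ₗ ρ j⁻¹ = _
    rw [← h2]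
    apply h3
    change (((j : G) • (x.out : G ⧸ J) : G ⧸ J)) = _
    simp
  change (∑ᶠ x : G ⧸ J, T x.out) ∘ₗ ρ j = π j ∘ₗ ∑ᶠ x : G ⧸ J, T x.out
  nth_rewrite 1 [← key]
  ext x
  simp [L, hρ]

lemma heckeAlgebra_finite [IsTopologicalGroup G] (hJ : IsOpen (J : Set G)) (φ : heckeAlgebra ρ) :
    {x : G ⧸ J | φ.1 x.out ≠ 0}.Finite := by
  obtain ⟨C, hC, hφ⟩ := φ.2.2
  have : DiscreteTopology (G ⧸ J) := QuotientGroup.discreteTopology hJ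
  refine (hC.image (QuotientGroup.continuous_mk (N := J))).finite_of_discrete.subset ?_
  intro x hx
  refine ⟨x.out, ?_, by simp⟩
  by_contra h
  exact hx (hφ _ h)

variable [MeasurableSpace G] (μ : MeasureTheory.Measure G)

/-- The convolution `(φ ⋆ Ψ)(g) = ∫_G φ(x) Ψ(x⁻¹ g) dμ(x)` for `φ ∈ H_ρ` and `Ψ ∈ H̄_ρ`, `μ` being a
Haar measure. The integrand is constant on the cosets `x J`, and vanishes on all but finitely many
of them, so that the integral is `μ(J)` times a finite sum over `G / J`. -/
def convolution (J : Subgroup G) (φ Ψ : G → Module.End ℂ (Module.Dual ℂ W)) (g : G) :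
    Module.End ℂ (Module.Dual ℂ W) :=
  (μ.real (J : Set G) : ℂ) • ∑ᶠ x : G ⧸ J, φ x.out ∘ₗ Ψ (x.out⁻¹ * g)

/-- The action of `H_ρ` on `M_ρ(π) = Hom_J(ρ, π)`:
`(φ · h)(w) = ∫_G π(x) h(ᵗφ(x) w) dμ(x)`, which is `μ(J)` times a finite sum over `G / J`.
Under Frobenius reciprocity `Hom_J(ρ, π) = Hom_G(ind_J^G ρ, π)` this is composition with the right
action `f ↦ φ̃ ⋆ f` of `φ` on the compactly induced representation, where `φ̃(g) = ᵗφ(g⁻¹)`. -/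
def heckeAction [FiniteDimensional ℂ W] (φ : heckeAlgebra ρ) (h : HomJ ρ π) : HomJ ρ π where
  toLinearMap := (μ.real (J : Set G) : ℂ) •
    ∑ᶠ x : G ⧸ J, π x.out ∘ₗ h.toLinearMap ∘ₗ transpose (φ.1 x.out)
  isIntertwining' j := by
    rw [LinearMap.smul_comp, heckeAction_equivariant]
    exact (LinearMap.comp_smul _ _ _).symm

/-- `H_ρ` acts on `M_ρ(π)` through `χ`. -/
def ActsThrough [FiniteDimensional ℂ W] (χ : heckeAlgebra ρ → ℂ) : Prop :=
  ∀ (φ : heckeAlgebra ρ) (h : HomJ ρ π), heckeAction ρ π μ φ h = χ φ • h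

/-- If `M_ρ(π)` is a line, then `H_ρ` acts on it through exactly one `χ`. -/
lemma existsUnique_actsThrough [FiniteDimensional ℂ W] (h1 : Module.finrank ℂ (HomJ ρ π) = 1) :
    ∃! χ : heckeAlgebra ρ → ℂ, ActsThrough ρ π μ χ := by
  obtain ⟨h₀, hne, hspan⟩ := finrank_eq_one_iff'.1 h1
  choose χ hχ using fun φ => hspan (heckeAction ρ π μ φ h₀)
  refine ⟨χ, fun φ h => ?_, fun χ' hχ' => funext fun φ => ?_⟩
  · obtain ⟨c, rfl⟩ := hspan h
    rw [smul_comm, hχ]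
    apply Representation.IntertwiningMap.ext
    change (μ.real (J : Set G) : ℂ) • _ = c • (μ.real (J : Set G) : ℂ) • _
    rw [smul_comm c, smul_finsum c fun x : G ⧸ J => _]
    simp [LinearMap.smul_comp, LinearMap.comp_smul]
  · exact smul_left_injective ℂ hne ((hχ' φ h₀).symm.trans (hχ φ).symm)

/-- The space `{Ψ ∈ H̄_ρ | φ ⋆ Ψ = χ(φ) Ψ for all φ ∈ H_ρ}`. -/
def eigenspace [IsTopologicalGroup G] (hJ : IsOpen (J : Set G)) (χ : heckeAlgebra ρ → ℂ) :
    Submodule ℂ (G → Module.End ℂ (Module.Dual ℂ W)) where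
  carrier := {Ψ | Ψ ∈ bigHecke ρ ∧ ∀ φ : heckeAlgebra ρ, convolution μ J φ.1 Ψ = χ φ • Ψ}
  zero_mem' := by
    refine ⟨zero_mem _, fun φ => ?_⟩
    ext1 g
    simp [convolution]
  add_mem' := by
    rintro Ψ Ψ' ⟨h, e⟩ ⟨h', e'⟩
    refine ⟨add_mem h h', fun φ => ?_⟩
    rw [smul_add, ← e φ, ← e' φ]
    ext1 g
    have fin : ∀ Θ : G → Module.End ℂ (Module.Dual ℂ W),
        (Function.support fun x : G ⧸ J => φ.1 x.out ∘ₗ Θ (x.out⁻¹ * g)).Finite := fun Θ =>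
      (heckeAlgebra_finite ρ hJ φ).subset fun x hx h0 => hx (by simp [h0])
    simp only [convolution, Pi.add_apply, LinearMap.comp_add]
    rw [finsum_add_distrib (fin Ψ) (fin Ψ'), smul_add]
  smul_mem' := by
    rintro c Ψ ⟨h, e⟩
    refine ⟨Submodule.smul_mem _ c h, fun φ => ?_⟩
    rw [smul_comm, ← e φ]
    ext1 g
    simp only [convolution, Pi.smul_apply, LinearMap.comp_smul]
    rw [smul_comm c, smul_finsum c fun x : G ⧸ J => φ.1 x.out ∘ₗ Ψ (x.out⁻¹ * g)]

end Smooth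

end TypeTheory

end

/-! An eigenfunction `Ψ` is determined by the single number `tr Ψ(1)`. If `φ` is supported on `J x⁻¹
J`, each nonzero term of the sum for `(φ ⋆ Ψ)(1)` has trace `tr(φ(x⁻¹) Ψ(x))`, so the eigenvalue
equation makes this number a multiple of `tr Ψ(1)`. The value `φ(x⁻¹)` may be any operator with the
equivariance under `J ∩ x⁻¹Jx` that the double coset forces, and averaging over this compact group
(`exists_equivariant_trace_eq`) shows that such operators detect `Ψ(x) ≠ 0`. Hence `tr Ψ(1) = 0`
implies `Ψ = 0` (`eq_zero_of_mem_eigenspace`), which bounds the dimension by one.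

Conversely, take `h ≠ 0` in `Hom_J(ρ, π)` and average a linear left inverse of `h` to a `J`-map `p :
V → W`. Then `Ψ₀(g) = ᵗ(p π(g⁻¹) h)` is an eigenfunction because `h` is an eigenvector, and `tr
Ψ₀(1) = dim W ≠ 0`. So every eigenfunction is a multiple of `Ψ₀`, and `⟨x, Ψ₀(g⁻¹)ξ⟩ = ξ(p(π(g)
h(x)))` is visibly a matrix coefficient. -/

namespace TypeTheory

/-! ### Smooth representations and averaging over a compact group. -/

section Averaging

open MeasureTheory

variable {K : Type*} [Group K] [TopologicalSpace K]
  {V : Type*} [AddCommGroup V] [Module ℂ V] {W : Type*} [AddCommGroup W] [Module ℂ W]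

lemma IsSmooth.of_isLocallyConstant {σ : Representation ℂ K V}
    (hσ : ∀ x, IsLocallyConstant fun k => σ k x) : IsSmooth σ :=
  fun x => (hσ x).isOpen_fiber x

lemma IsSmooth.comp_continuous {L : Type*} [Group L] [TopologicalSpace L]
    {σ : Representation ℂ K V} (hσ : IsSmooth σ) (f : L →* K) (hf : Continuous f) :
    IsSmooth (MonoidHom.comp σ f) :=
  fun x => (hσ x).preimage hf

variable [IsTopologicalGroup K]

lemma IsSmooth.isLocallyConstant_apply {σ : Representation ℂ K V} (hσ : IsSmooth σ) (x : V) :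
    IsLocallyConstant fun k => σ k x := by
  refine (IsLocallyConstant.iff_exists_open _).2 fun k =>
    ⟨(fun l => k⁻¹ * l) ⁻¹' {g | σ g x = x}, (hσ x).preimage (continuous_const_mul _), ?_, ?_⟩
  · simp
  · intro l hl
    have h : σ (k⁻¹ * l) x = x := hl
    have := congrArg (σ k) h
    rwa [← Module.End.mul_apply, ← map_mul, mul_inv_cancel_left] at this

lemma IsSmooth.isLocallyConstant [FiniteDimensional ℂ W] {τ : Representation ℂ K W}
    (hτ : IsSmooth τ) : IsLocallyConstant fun k => τ k := by
  let b := Module.finBasis ℂ W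
  refine (IsLocallyConstant.iff_eventually_eq _).2 fun k => ?_
  have := Filter.eventually_all.2 fun i =>
    (IsLocallyConstant.iff_eventually_eq _).1 (hτ.isLocallyConstant_apply (b i)) k
  filter_upwards [this] with l hl
  exact b.ext hl

lemma IsSmooth.dual [FiniteDimensional ℂ W] {τ : Representation ℂ K W} (hτ : IsSmooth τ) :
    IsSmooth τ.dual :=
  .of_isLocallyConstant fun ξ =>
    (hτ.isLocallyConstant.comp_continuous continuous_inv).comp fun a : W →ₗ[ℂ] W => ξ ∘ₗ a

lemma trace_eq_sum_coord {ι : Type*} [Fintype ι] (b : Module.Basis ι ℂ W) (f : W →ₗ[ℂ] W) :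
    LinearMap.trace ℂ W f = ∑ i, b.coord i (f (b i)) := by
  classical
  simp [LinearMap.trace_eq_matrix_trace ℂ b, Matrix.trace, LinearMap.toMatrix_apply]

/-- Averaging a linear map over a compact group: every linear map `q : V → W` has an equivariant
average, which has the same trace pairing as `q` with all equivariant maps `W → V`. -/
theorem exists_equivariant_trace_eq [CompactSpace K] [FiniteDimensional ℂ W]
    {σ : Representation ℂ K V} {τ : Representation ℂ K W} (hσ : IsSmooth σ) (hτ : IsSmooth τ)
    (q : V →ₗ[ℂ] W) :
    ∃ p : V →ₗ[ℂ] W, (∀ k, p ∘ₗ σ k = τ k ∘ₗ p) ∧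
      ∀ b : W →ₗ[ℂ] V, (∀ k, b ∘ₗ τ k = σ k ∘ₗ b) →
        LinearMap.trace ℂ W (p ∘ₗ b) = LinearMap.trace ℂ W (q ∘ₗ b) := by
  borelize K
  let ν : Measure K := Measure.haarMeasure ⊤
  have : IsProbabilityMeasure ν :=
    ⟨Measure.haarMeasure_self (K₀ := (⊤ : TopologicalSpace.PositiveCompacts K))⟩
  have int : ∀ (x : V) (ξ : Module.Dual ℂ W),
      Integrable (fun k => ξ (τ k (q (σ k⁻¹ x)))) ν := fun x ξ => by
    have hc : IsLocallyConstant fun k => ξ (τ k (q (σ k⁻¹ x))) :=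
      hτ.isLocallyConstant.comp₂
        ((hσ.isLocallyConstant_apply x).comp_continuous continuous_inv)
        fun (a : W →ₗ[ℂ] W) y => ξ (a (q y))
    exact hc.continuous.integrable_of_hasCompactSupport (HasCompactSupport.of_compactSpace _)
  -- `p = ∫ τ(k) q σ(k)⁻¹ dk` is defined weakly, through scalar integrals and the bidual of `W`, so
  -- that no topology on `V` or `W` is needed.
  let B : V →ₗ[ℂ] Module.Dual ℂ (Module.Dual ℂ W) :=
    LinearMap.mk₂ ℂ (fun x ξ => ∫ k, ξ (τ k (q (σ k⁻¹ x))) ∂ν)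
      (fun x y ξ => by simp only [map_add]; exact integral_add (int x ξ) (int y ξ))
      (fun c x ξ => by simp only [map_smul]; exact integral_smul c _)
      (fun x ξ η => by simp only [LinearMap.add_apply]; exact integral_add (int x ξ) (int x η))
      (fun c x ξ => by simp only [LinearMap.smul_apply]; exact integral_smul c _)
  obtain ⟨p, hp⟩ : ∃ p : V →ₗ[ℂ] W, ∀ x (ξ : Module.Dual ℂ W),
      ξ (p x) = ∫ k, ξ (τ k (q (σ k⁻¹ x))) ∂ν :=
    ⟨(Module.evalEquiv ℂ W).symm.toLinearMap ∘ₗ B, fun x ξ =>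
      Module.apply_evalEquiv_symm_apply ℂ W ξ (B x)⟩
  refine ⟨p, fun l => ?_, fun b hb => ?_⟩
  · ext x
    refine sub_eq_zero.1 ((Module.forall_dual_apply_eq_zero_iff ℂ _).1 fun ξ => ?_)
    rw [map_sub, sub_eq_zero, LinearMap.comp_apply, LinearMap.comp_apply, hp]
    refine Eq.trans ?_ (hp x (ξ ∘ₗ τ l)).symm
    rw [← integral_mul_left_eq_self _ l]
    refine integral_congr_ae (.of_forall fun k => ?_)
    simp [← Module.End.mul_apply, ← map_mul, mul_assoc]
  · let e := Module.finBasis ℂ W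
    -- By equivariance of `b` the integrand is a conjugate of `q ∘ b`: its trace is constant, and
    -- the total mass is one.
    have h : ∀ k, τ k ∘ₗ q ∘ₗ σ k⁻¹ ∘ₗ b = τ k * (q ∘ₗ b) * τ k⁻¹ := fun k => by
      rw [← hb, Module.End.mul_eq_comp, Module.End.mul_eq_comp, LinearMap.comp_assoc,
        LinearMap.comp_assoc]
    rw [trace_eq_sum_coord e]
    simp only [LinearMap.comp_apply, hp]
    rw [← integral_finsetSum _ fun i _ => int _ _]
    have h' : ∀ k, ∑ i, e.coord i (τ k (q (σ k⁻¹ (b (e i))))) =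
        LinearMap.trace ℂ W (q ∘ₗ b) := fun k => by
      refine (trace_eq_sum_coord e (τ k ∘ₗ q ∘ₗ σ k⁻¹ ∘ₗ b)).symm.trans ?_
      rw [h, LinearMap.trace_mul_comm,
        ← mul_assoc, ← map_mul]
      simp
    simp only [h', integral_const, probReal_univ, one_smul]

end Averaging

/-! ### Uniqueness: an eigenfunction is determined by the trace at the identity. -/

section Eigenspace

variable {G : Type*} [Group G] [TopologicalSpace G] [IsTopologicalGroup G] {J : Subgroup G}
  {W : Type*} [AddCommGroup W] [Module ℂ W] {ρ : Representation ℂ J W}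

/-- An element of `End(W̃)` that intertwines `ρ̃` with its conjugate by `y` extends to an element of
the Hecke algebra supported on the double coset `J y J`. -/
lemma exists_heckeAlgebra_of_intertwines (hJ : IsCompact (J : Set G)) (y : G)
    (a : Module.End ℂ (Module.Dual ℂ W))
    (ha : ∀ j l : J, (j * y : G) = y * l → ρ.dual j * a = a * ρ.dual l) :
    ∃ φ : heckeAlgebra ρ, (∀ j l : J, φ.1 (j * y * l) = ρ.dual j * a * ρ.dual l) ∧
      ∀ g, (∀ j l : J, g ≠ j * y * l) → φ.1 g = 0 := by
  classical
  let f : G → Module.End ℂ (Module.Dual ℂ W) := fun g =>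
    if h : ∃ p : J × J, g = p.1 * y * p.2 then ρ.dual h.choose.1 * a * ρ.dual h.choose.2 else 0
  have h0 : ∀ g, (∀ j l : J, g ≠ j * y * l) → f g = 0 := fun g hg =>
    dif_neg fun ⟨p, hp⟩ => hg p.1 p.2 hp
  have h1 : ∀ j l : J, f (j * y * l) = ρ.dual j * a * ρ.dual l := fun j l => by
    have h : ∃ p : J × J, (j * y * l : G) = p.1 * y * p.2 := ⟨(j, l), rfl⟩
    obtain ⟨p, hp, he⟩ : ∃ p : J × J, (j * y * l : G) = p.1 * y * p.2 ∧
        f (j * y * l) = ρ.dual p.1 * a * ρ.dual p.2 := ⟨_, h.choose_spec, dif_pos h⟩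
    -- The chosen decomposition `p.1 * y * p.2` may differ from `j * y * l`; `ha`, applied to the
    -- discrepancy, shows that both give the same value.
    have key := ha (p.1⁻¹ * j) (p.2 * l⁻¹) (by
      push_cast
      rw [mul_assoc, inv_mul_eq_iff_eq_mul, ← mul_assoc, ← mul_assoc, ← hp]
      group)
    have h2 := congrArg (fun b => ρ.dual p.1 * b * ρ.dual l) key
    simp only [← mul_assoc, ← map_mul, mul_inv_cancel, one_mul] at h2
    simp only [mul_assoc, ← map_mul, inv_mul_cancel, mul_one] at h2
    rw [he, mul_assoc, mul_assoc, ← h2]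
  refine ⟨⟨f, fun j l g => ?_, (fun p : G × G => p.1 * y * p.2) '' ((J : Set G) ×ˢ (J : Set G)),
    (hJ.prod hJ).image (by fun_prop), fun g hg => h0 g ?_⟩, h1, h0⟩
  · by_cases hg : ∃ j' l' : J, g = j' * y * l'
    · obtain ⟨j', l', rfl⟩ := hg
      have e : (j * (j' * y * l') * l : G) = (j * j' : J) * y * (l' * l : J) := by
        push_cast; group
      rw [e, h1, h1, map_mul, map_mul]
      rfl
    · push Not at hg
      rw [h0 g hg, h0]
      · simp
      · intro j' l' e
        refine hg (j⁻¹ * j') (l' * l⁻¹) ?_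
        rw [mul_assoc, ← eq_inv_mul_iff_mul_eq, ← eq_mul_inv_iff_mul_eq] at e
        rw [e]
        push_cast
        group
  · rintro j l rfl
    exact hg ⟨(j, l), ⟨j.2, l.2⟩, rfl⟩

/-- The trace pairing is nondegenerate, and rank one maps suffice: `q = f(·) z` gives `tr(q b) = f(b
z)`. -/
lemma exists_trace_comp_ne_zero {U U' : Type*} [AddCommGroup U] [Module ℂ U] [AddCommGroup U']
    [Module ℂ U'] [FiniteDimensional ℂ U] {b : U →ₗ[ℂ] U'} (hb : b ≠ 0) :
    ∃ q : U' →ₗ[ℂ] U, LinearMap.trace ℂ U (q ∘ₗ b) ≠ 0 := by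
  obtain ⟨z, hz⟩ : ∃ z, b z ≠ 0 := by
    by_contra! h
    exact hb (LinearMap.ext h)
  obtain ⟨f, hf⟩ : ∃ f : Module.Dual ℂ U', f (b z) ≠ 0 := by
    by_contra! h
    exact hz ((Module.forall_dual_apply_eq_zero_iff ℂ _).1 h)
  refine ⟨f.smulRight z, ?_⟩
  have : f.smulRight z ∘ₗ b = (f ∘ₗ b).smulRight z := rfl
  rwa [this, LinearMap.trace_smulRight]

/-- For `Ψ ∈ H̄_ρ` with `Ψ(x) ≠ 0`, the value `Ψ(x)` pairs non-trivially with an intertwiner of `ρ̃`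
with its conjugate by `x⁻¹`. -/
lemma exists_intertwiner_trace_ne_zero [FiniteDimensional ℂ W] (hJo : IsOpen (J : Set G))
    (hJ : IsCompact (J : Set G)) (hρ : IsSmooth ρ) {Ψ : G → Module.End ℂ (Module.Dual ℂ W)}
    (hΨ : Ψ ∈ bigHecke ρ) {x : G} (hx : Ψ x ≠ 0) :
    ∃ a : Module.End ℂ (Module.Dual ℂ W),
      (∀ j l : J, (j * x⁻¹ : G) = x⁻¹ * l → ρ.dual j * a = a * ρ.dual l) ∧
        LinearMap.trace ℂ _ (a * Ψ x) ≠ 0 := by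
  -- `H = J ∩ x⁻¹Jx` acts on `W̃` through `c` (inclusion) and `c'` (conjugation by `x`); `Ψ(x)`
  -- intertwines the first action with the second, and `a` must go back.
  let H : Subgroup G := J ⊓ J.comap (MulAut.conj x).toMonoidHom
  have hcont : Continuous fun g : G => x * g * x⁻¹ := by fun_prop
  have hH : IsCompact (H : Set G) :=
    hJ.inter_right ((J.isClosed_of_isOpen hJo).preimage hcont)
  have : CompactSpace H := isCompact_iff_compactSpace.1 hH
  let c : H →* J := Subgroup.inclusion inf_le_left
  let c' : H →* J := ((MulAut.conj x).toMonoidHom.comp H.subtype).codRestrict J fun g => g.2.2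
  have hc : Continuous c := continuous_subtype_val.subtype_mk _
  have hc' : Continuous c' := (hcont.comp continuous_subtype_val).subtype_mk _
  obtain ⟨q, hq⟩ := exists_trace_comp_ne_zero hx
  obtain ⟨a, ha, hat⟩ := exists_equivariant_trace_eq (hρ.dual.comp_continuous c' hc')
    (hρ.dual.comp_continuous c hc) q
  refine ⟨a, fun j l e => ?_, ?_⟩
  · have e' : x * j * x⁻¹ = l := by rw [mul_assoc, e]; group
    have hj : (j : G) ∈ H := ⟨j.2, by change x * j * x⁻¹ ∈ J; rw [e']; exact l.2⟩
    have hl : c' ⟨j, hj⟩ = l := Subtype.ext e'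
    have := ha ⟨j, hj⟩
    rw [← hl]
    exact this.symm
  · rw [Module.End.mul_eq_comp, hat (Ψ x)]
    · exact hq
    · intro k
      have h1 := hΨ 1 (c k) x
      have h2 := hΨ (c' k) 1 x
      simp only [OneMemClass.coe_one, one_mul, mul_one, map_one] at h1 h2
      have e : (x * (c k : J) : G) = (c' k : J) * x := by
        change x * (k : G) = x * k * x⁻¹ * x
        group
      exact h1.symm.trans ((congrArg Ψ e).trans h2)

variable [MeasurableSpace G] {μ : MeasureTheory.Measure G}

/-- An eigenfunction of the Hecke algebra is determined by the trace of its value at `1`. -/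
theorem eq_zero_of_mem_eigenspace [μ.IsHaarMeasure] [FiniteDimensional ℂ W]
    (hJo : IsOpen (J : Set G)) (hJ : IsCompact (J : Set G)) (hρ : IsSmooth ρ)
    {χ : heckeAlgebra ρ → ℂ} {Ψ : G → Module.End ℂ (Module.Dual ℂ W)}
    (hΨ : Ψ ∈ eigenspace ρ μ hJo χ) (h1 : LinearMap.trace ℂ _ (Ψ 1) = 0) : Ψ = 0 := by
  funext x
  by_contra hx
  obtain ⟨a, ha, hat⟩ := exists_intertwiner_trace_ne_zero hJo hJ hρ hΨ.1 hx
  obtain ⟨φ, hφ, hφ0⟩ := exists_heckeAlgebra_of_intertwines hJ x⁻¹ a ha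
  have hμ : (μ.real (J : Set G) : ℂ) ≠ 0 := by
    refine Complex.ofReal_ne_zero.2 (ENNReal.toReal_ne_zero.2 ⟨?_, hJ.measure_lt_top.ne⟩)
    exact (hJo.measure_pos μ ⟨1, J.one_mem⟩).ne'
  -- The factors `ρ̃(l)`, `ρ̃(l⁻¹)` cancel inside the product, and `ρ̃(j)`, `ρ̃(j⁻¹)` by cyclicity
  -- of the trace.
  have hterm : ∀ j l : J, LinearMap.trace ℂ _
      (φ.1 (j * x⁻¹ * l) * Ψ ((j * x⁻¹ * l : G)⁻¹ * 1)) = LinearMap.trace ℂ _ (a * Ψ x) := by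
    intro j l
    have e : ((j * x⁻¹ * l : G)⁻¹ * 1) = (l⁻¹ : J) * x * (j⁻¹ : J) := by push_cast; group
    rw [hφ, e, hΨ.1, ← Module.End.mul_eq_comp, ← Module.End.mul_eq_comp]
    have e2 : ρ.dual j * a * ρ.dual l * (ρ.dual l⁻¹ * (Ψ x * ρ.dual j⁻¹)) =
        ρ.dual j * (a * Ψ x) * ρ.dual j⁻¹ := by
      have : ρ.dual l * ρ.dual l⁻¹ = 1 := by rw [← map_mul, mul_inv_cancel, map_one]
      simp only [mul_assoc]
      rw [← mul_assoc (ρ.dual l), this, one_mul]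
    rw [e2, LinearMap.trace_mul_comm, ← mul_assoc, ← map_mul, inv_mul_cancel, map_one, one_mul]
  have hfin := heckeAlgebra_finite ρ hJo φ
  have hsum : LinearMap.trace ℂ _ (∑ᶠ y : G ⧸ J, φ.1 y.out ∘ₗ Ψ (y.out⁻¹ * 1)) =
      hfin.toFinset.card • LinearMap.trace ℂ _ (a * Ψ x) := by
    rw [finsum_eq_sum_of_support_subset (s := hfin.toFinset) _ fun y hy => by
      rw [Set.Finite.coe_toFinset]
      intro h0
      exact hy (by simp [h0]), map_sum]
    refine Finset.sum_eq_card_nsmul fun y hy => ?_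
    obtain ⟨j, l, e⟩ : ∃ j l : J, y.out = j * x⁻¹ * l := by
      by_contra! h
      exact (hfin.mem_toFinset.1 hy) (hφ0 _ h)
    rw [e]
    exact hterm j l
  -- The coset of `x⁻¹` is counted: if `φ` vanished there, `hterm` would give `tr(a Ψ(x)) = 0`.
  have hcard : hfin.toFinset.card ≠ 0 := by
    obtain ⟨l, hl⟩ := QuotientGroup.mk_out_eq_mul J x⁻¹
    refine Finset.card_ne_zero_of_mem (a := (x⁻¹ : G))
      (hfin.mem_toFinset.2 fun h0 : φ.1 _ = 0 => hat ?_)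
    rw [← hterm 1 l, OneMemClass.coe_one, one_mul, ← hl, h0, zero_mul, map_zero]
  have := congrArg (LinearMap.trace ℂ _) (congrFun (hΨ.2 φ) 1)
  simp only [convolution, Pi.smul_apply, map_smul, hsum, h1, smul_zero] at this
  simp [hμ, hcard, hat] at this

end Eigenspace

/-! ### Existence: eigenfunctions built from matrix coefficients. -/

section MatrixCoefficient

variable {G : Type*} [Group G] {J : Subgroup G}
  {W : Type*} [AddCommGroup W] [Module ℂ W] {ρ : Representation ℂ J W}
  {V : Type*} [AddCommGroup V] [Module ℂ V] {π : Representation ℂ G V}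

/-- The function `g ↦ ᵗ(p π(g⁻¹) h)` attached to linear maps `h : W → V` and `p : V → W`. -/
def coefficientFunction (π : Representation ℂ G V) (h : W →ₗ[ℂ] V) (p : V →ₗ[ℂ] W) (g : G) :
    Module.End ℂ (Module.Dual ℂ W) :=
  Module.Dual.transpose (R := ℂ) (p ∘ₗ π g⁻¹ ∘ₗ h)

lemma coefficientFunction_apply (h : W →ₗ[ℂ] V) (p : V →ₗ[ℂ] W) (g : G) (ξ : Module.Dual ℂ W)
    (x : W) : coefficientFunction π h p g ξ x = ξ (p (π g⁻¹ (h x))) :=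
  rfl

lemma coefficientFunction_mem_bigHecke (h : HomJ ρ π) {p : V →ₗ[ℂ] W}
    (hp : ∀ j : J, p ∘ₗ π j = ρ j ∘ₗ p) :
    coefficientFunction π h.toLinearMap p ∈ bigHecke ρ := by
  intro j l g
  ext ξ x
  have hp' : ∀ (j : J) y, p (π j y) = ρ j (p y) := fun j y => LinearMap.congr_fun (hp j) y
  have hh : ∀ (j : J) y, h.toLinearMap (ρ j y) = π j (h.toLinearMap y) := fun j y =>
    LinearMap.congr_fun (h.isIntertwining' j) y
  have e : (j * g * l : G)⁻¹ = (l⁻¹ : J) * g⁻¹ * (j⁻¹ : J) := by push_cast; group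
  rw [coefficientFunction_apply, e, map_mul, map_mul, Module.End.mul_apply, Module.End.mul_apply,
    hp', ← hh]
  rfl

variable [TopologicalSpace G]

/-- Pulling the sum over `G ⧸ J` inside the transpose gives `(φ ⋆ Ψ)(g) = ᵗ(p π(g⁻¹) (φ · h))`, and
`φ · h = χ(φ) h`. -/
lemma coefficientFunction_mem_eigenspace [IsTopologicalGroup G] [MeasurableSpace G]
    {μ : MeasureTheory.Measure G} [FiniteDimensional ℂ W] (hJ : IsOpen (J : Set G))
    {χ : heckeAlgebra ρ → ℂ} (hχ : ActsThrough ρ π μ χ) (h : HomJ ρ π) {p : V →ₗ[ℂ] W}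
    (hp : ∀ j : J, p ∘ₗ π j = ρ j ∘ₗ p) :
    coefficientFunction π h.toLinearMap p ∈ eigenspace ρ μ hJ χ := by
  refine ⟨coefficientFunction_mem_bigHecke h hp, fun φ => ?_⟩
  ext g ξ x
  have hfin := heckeAlgebra_finite ρ hJ φ
  have h1 : ∑ᶠ y : G ⧸ J, π y.out ∘ₗ h.toLinearMap ∘ₗ transpose (φ.1 y.out) =
      ∑ y ∈ hfin.toFinset, π y.out ∘ₗ h.toLinearMap ∘ₗ transpose (φ.1 y.out) :=
    finsum_eq_sum_of_support_subset _ fun y hy => by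
      rw [Set.Finite.coe_toFinset]
      intro h0
      exact hy (by simp [h0, transpose])
  have h2 : ∑ᶠ y : G ⧸ J, φ.1 y.out ∘ₗ coefficientFunction π h.toLinearMap p (y.out⁻¹ * g) =
      ∑ y ∈ hfin.toFinset,
        φ.1 y.out ∘ₗ coefficientFunction π h.toLinearMap p (y.out⁻¹ * g) :=
    finsum_eq_sum_of_support_subset _ fun y hy => by
      rw [Set.Finite.coe_toFinset]
      intro h0
      exact hy (by simp [h0])
  have key : (μ.real (J : Set G) : ℂ) •
      ∑ y ∈ hfin.toFinset, π y.out (h.toLinearMap (transpose (φ.1 y.out) x)) =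
        χ φ • h.toLinearMap x := by
    have := congrArg (fun k : HomJ ρ π => k.toLinearMap x) (hχ φ h)
    change ((μ.real (J : Set G) : ℂ) • ∑ᶠ y : G ⧸ J,
      π y.out ∘ₗ h.toLinearMap ∘ₗ transpose (φ.1 y.out) : W →ₗ[ℂ] V) x =
        χ φ • h.toLinearMap x at this
    rw [h1] at this
    simpa only [LinearMap.smul_apply, LinearMap.sum_apply, LinearMap.comp_apply] using this
  have key2 := congrArg (fun y => ξ (p (π g⁻¹ y))) key
  simp only [map_smul, map_sum] at key2
  simp only [convolution, h2, Pi.smul_apply, LinearMap.smul_apply, LinearMap.sum_apply,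
    LinearMap.comp_apply]
  rw [coefficientFunction_apply]
  refine Eq.trans ?_ key2
  congr 1
  refine Finset.sum_congr rfl fun y _ => ?_
  rw [← apply_transpose, coefficientFunction_apply, mul_inv_rev, inv_inv, map_mul]
  rfl

/-- The form `ξ ∘ p` is smooth because its stabilizer contains the stabilizer of `ξ` in the open
subgroup `J`. -/
lemma isMatrixCoefficient_coefficientFunction [IsTopologicalGroup G] [FiniteDimensional ℂ W]
    (hJ : IsOpen (J : Set G)) (hρ : IsSmooth ρ) (h : W →ₗ[ℂ] V) {p : V →ₗ[ℂ] W}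
    (hp : ∀ j : J, p ∘ₗ π j = ρ j ∘ₗ p) (x : W) (ξ : Module.Dual ℂ W) :
    IsMatrixCoefficient π fun g => coefficientFunction π h p g⁻¹ ξ x := by
  refine ⟨h x, ξ ∘ₗ p, ?_, fun g => ?_⟩
  · let S : Subgroup G :=
      { carrier := {g | π.dual g (ξ ∘ₗ p) = ξ ∘ₗ p}
        one_mem' := (LinearMap.congr_fun (map_one π.dual) _ :)
        mul_mem' := by
          intro a b (ha : π.dual a _ = _) (hb : π.dual b _ = _)
          change π.dual (a * b) _ = _
          rw [map_mul, Module.End.mul_apply, hb, ha]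
        inv_mem' := by
          intro a (ha : π.dual a _ = _)
          change π.dual a⁻¹ _ = _
          nth_rewrite 1 [← ha]
          rw [← Module.End.mul_apply, ← map_mul, inv_mul_cancel, map_one, Module.End.one_apply] }
    change IsOpen (S : Set G)
    refine S.isOpen_of_mem_nhds (g := 1) (Filter.mem_of_superset
      ((hJ.isOpenMap_subtype_val _ (hρ.dual ξ)).mem_nhds
        ⟨1, (LinearMap.congr_fun (map_one ρ.dual) ξ :), rfl⟩) ?_)
    rintro _ ⟨j, hj, rfl⟩
    change (ξ ∘ₗ p) ∘ₗ π (j⁻¹ : J) = ξ ∘ₗ p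
    rw [LinearMap.comp_assoc, hp, ← LinearMap.comp_assoc]
    exact congrArg (· ∘ₗ p) hj
  · simp only [coefficientFunction_apply, inv_inv, LinearMap.comp_apply]

lemma IsMatrixCoefficient.smul {c : G → ℂ} (hc : IsMatrixCoefficient π c) (a : ℂ) :
    IsMatrixCoefficient π fun g => a * c g := by
  obtain ⟨x, ξ, hξ, h⟩ := hc
  exact ⟨a • x, ξ, hξ, fun g => by simp [h]⟩

end MatrixCoefficient

/-- The eigenspace of the Hecke algebra attached to a representation `π` with
`dim Hom_J(ρ, π) = 1` is spanned by a function whose values are matrix coefficients of `π`. -/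
theorem exists_span_eigenspace {G : Type*} [Group G] [TopologicalSpace G] [IsTopologicalGroup G]
    [MeasurableSpace G] {μ : MeasureTheory.Measure G} [μ.IsHaarMeasure] {J : Subgroup G}
    {W : Type*} [AddCommGroup W] [Module ℂ W] [FiniteDimensional ℂ W] {ρ : Representation ℂ J W}
    {V : Type*} [AddCommGroup V] [Module ℂ V] {π : Representation ℂ G V}
    (hJo : IsOpen (J : Set G)) (hJ : IsCompact (J : Set G)) (hρ : IsSmooth ρ)
    (hρi : ρ.IsIrreducible) (hπ : IsSmooth π) (hH : Module.finrank ℂ (HomJ ρ π) = 1)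
    {χ : heckeAlgebra ρ → ℂ} (hχ : ActsThrough ρ π μ χ) :
    ∃ Ψ₀ ∈ eigenspace ρ μ hJo χ,
      (∀ (x : W) (ξ : Module.Dual ℂ W), IsMatrixCoefficient π fun g => Ψ₀ g⁻¹ ξ x) ∧
        ∀ Ψ ∈ eigenspace ρ μ hJo χ, ∃ c : ℂ, c • Ψ₀ = Ψ := by
  obtain ⟨h, hne, -⟩ := finrank_eq_one_iff'.1 hH
  have hinj : Function.Injective h.toLinearMap :=
    (Representation.IsIrreducible.injective_or_eq_zero h).resolve_right hne
  have : Nontrivial W := by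
    by_contra hW
    rw [not_nontrivial_iff_subsingleton] at hW
    exact hne (Representation.IntertwiningMap.ext (Subsingleton.elim _ _))
  -- `q` is only linear; its average `p` is a `J`-map that still satisfies `tr(p h) = tr(q h) = dim
  -- W`.
  obtain ⟨q, hq⟩ := h.toLinearMap.exists_leftInverse_of_injective (LinearMap.ker_eq_bot.2 hinj)
  have : CompactSpace J := isCompact_iff_compactSpace.1 hJ
  obtain ⟨p, hp, hpt⟩ := exists_equivariant_trace_eq
    (hπ.comp_continuous J.subtype continuous_subtype_val) hρ q
  have hmem := coefficientFunction_mem_eigenspace hJo hχ h hp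
  have ht : LinearMap.trace ℂ _ (coefficientFunction π h.toLinearMap p 1) ≠ 0 := by
    have e : coefficientFunction π h.toLinearMap p 1 =
        Module.Dual.transpose (R := ℂ) (p ∘ₗ h.toLinearMap) := by
      rw [coefficientFunction, inv_one, map_one, Module.End.one_eq_id, LinearMap.id_comp]
    rw [e, LinearMap.trace_transpose', hpt _ h.isIntertwining', hq, LinearMap.trace_id]
    exact Nat.cast_ne_zero.2 Module.finrank_pos.ne'
  refine ⟨_, hmem, fun x ξ => isMatrixCoefficient_coefficientFunction hJo hρ _ hp x ξ,
    fun Ψ hΨ => ⟨LinearMap.trace ℂ _ (Ψ 1) /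
      LinearMap.trace ℂ _ (coefficientFunction π h.toLinearMap p 1), ?_⟩⟩
  -- The scalar is the ratio of the traces at `1`, so the difference has trace zero there.
  refine sub_eq_zero.1 (eq_zero_of_mem_eigenspace hJo hJ hρ
    (sub_mem (Submodule.smul_mem _ _ hmem) hΨ) ?_)
  simp [ht]

end TypeTheory

theorem mainTheorem8
    -- the connected reductive group `𝔾 = Spec A` over the local field `F`, and `G = 𝔾(F)`
    {F : Type*} [Field F] [ValuativeRel F] [TopologicalSpace F] [IsNonarchimedeanLocalField F]
    {A : Type*} [CommRing A] [HopfAlgebra F A] (hA : TypeTheory.IsConnectedReductive F A)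
    [MeasurableSpace (TypeTheory.RationalPoints F A)] [BorelSpace (TypeTheory.RationalPoints F A)]
    (μ : MeasureTheory.Measure (TypeTheory.RationalPoints F A)) [μ.IsHaarMeasure]
    -- the type `(J, ρ)`
    {J : Subgroup (TypeTheory.RationalPoints F A)}
    {W : Type*} [AddCommGroup W] [Module ℂ W] [FiniteDimensional ℂ W]
    (ρ : Representation ℂ J W)
    -- the irreducible representation `π` in `𝒮_ρ(G)`
    {V : Type v} [AddCommGroup V] [Module ℂ V]
    (π : Representation ℂ (TypeTheory.RationalPoints F A) V)
    (hρ : TypeTheory.IsType.{_, v, _} ρ)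
    (hπ : π.IsIrreducible) (hπρ : TypeTheory.MemCategory ρ π)
    -- hypothesis (H), and the character by which the Hecke algebra acts on `Hom_J(ρ, π)`
    (hH : Module.finrank ℂ (TypeTheory.HomJ ρ π) = 1)
    (χ : TypeTheory.heckeAlgebra ρ → ℂ) (hχ : TypeTheory.ActsThrough ρ π μ χ) :
    Module.rank ℂ (TypeTheory.eigenspace ρ μ hρ.isOpen χ) ≤ 1 ∧
      ∀ Ψ ∈ TypeTheory.eigenspace ρ μ hρ.isOpen χ, ∀ (w : W) (w' : Module.Dual ℂ W),
        TypeTheory.IsMatrixCoefficient π (fun g => (Ψ g⁻¹ w') w) := by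
  obtain ⟨Ψ₀, hΨ₀, hc, hspan⟩ := TypeTheory.exists_span_eigenspace (μ := μ) hρ.isOpen hρ.isCompact
    hρ.smooth hρ.irreducible hπρ.smooth hH hχ
  refine ⟨?_, fun Ψ hΨ w w' => ?_⟩
  · exact (Submodule.rank_mono fun Ψ hΨ => Submodule.mem_span_singleton.2 (hspan Ψ hΨ)).trans
      ((rank_span_le {Ψ₀}).trans_eq (Cardinal.mk_singleton Ψ₀))
  · obtain ⟨c, rfl⟩ := hspan Ψ hΨ
    exact (hc w w').smul c
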